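/- Let $[N]=\{1,\dots,N\}$ and let $\mathrm{SEARCH}_N:\{0,1\}^N\to\{0,1\}$ be the unstructured search problem: $\mathrm{SEARCH}_N(x)=1$ if and only if $x(i)=1$ for some $i\in[N]$. A *quantum algorithm with $Q$ non-adaptive queries and $P$ non-collapsing measurements* acts on finitely many qubits: $Q$ query registers, each holding an index $i$ and a control bit $b$, and a workspace. It is given by unitaries $U_0,\dots,U_P$, by collapsing measurements $M_1,\dots,M_P$, each measuring a (possibly empty) set of qubits in the computational basis, and by a classical output function. On input $x$ it applies $M_PU_P\cdots M_1U_1\,O_x^Q\,U_0$ to $|0\rangle$, where $$O_x^Q|i_1,b_1,\dots,i_Q,b_Q\rangle=(-1)^{\sum_{j=1}^Q x(i_j)b_j}|i_1,b_1,\dots,i_Q,b_Q\rangle$$ (indices outside $[N]$ count as $x(i)=0$). After each $M_t$ the current, collapsed, state is sampled once in the computational basis without being disturbed, giving $v_t$; the output is a function of $v_1,\dots,v_P$. The algorithm computes $f$ on a set $S$ of inputs if for each $x\in S$ the output differs from $f(x)$ with probability at most $1/3$. The non-adaptive complexity of $f$ is the least value of $Q+P$ over all such algorithms that compute $f$ on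 all inputs. Then the non-adaptive complexity of $\mathrm{SEARCH}_N$ is $\tilde\Theta(\sqrt N)$ ($\tilde\Theta$, $\tilde O$: up to factors polynomial in $\log N$). More precisely: 1. Let $X=\{0^N\}$, let $Y$ be the set of strings of Hamming weight one, and $R=X\times Y$. Let $m$ (respectively $m'$) be the least number of elements of $Y$ (of $X$) related to a given element of $X$ (of $Y$), and let $l$ (respectively $l'$) be the greatest number of elements of $Y$ (of $X$) that are related to a given element of $X$ (of $Y$) and differ from it at a given index. Then $m=N$ and $m'=l=l'=1$ for $N\ge1$, and there is a constant $c>0$ such that for all $N\ge 1$ every algorithm with $Q$ non-adaptive queries and $P$ non-collapsing measurements that computes $\mathrm{SEARCH}_N$ on $X\cup Y$ satisfies $QP\ge c\max\{m/l,\,m'/l'\}=cN$ and $Q+P\ge c\sqrt N$. 2. There are constants $C,k$ such that for every $N\ge 2$ some algorithm with $Q=\lceil\sqrt N\rceil$ non-adaptive queries and $P\le C\sqrt N(\log N)^k$ non-collapsing measurements computes $\mathrm{SEARCH}_N$ on all inputs. Moreover, $[N]$ can be partitioned into $\lceil\sqrt N\rceil$ sets of size at most $\lceil\sqrt N\rceil$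 such that the $j$-th of the parallel queries of this algorithm is made only to indices in the $j$-th set, for each $j$. -/

import Mathlib

noncomputable section

namespace PDQP

/-- The qubits of a non-adaptive circuit with `Q` parallel queries to an input of length `N`:
`Q` query registers, each of `Nat.clog 2 N` index qubits followed by one control qubit, and
`w` workspace qubits. -/
abbrev Qubit (N Q w : ℕ) : Type := (Fin Q × Fin (Nat.clog 2 N + 1)) ⊕ Fin w

/-- Labels of the computational basis states. -/
abbrev Basis (N Q w : ℕ) : Type := Qubit N Q w → Bool

/-- The state space of the qubits (states are its unit vectors). -/
abbrev State (N Q w : ℕ) : Type := EuclideanSpace ℂ (Basis N Q w)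

/-- Unitary operators on the whole state space. -/
abbrev UnitaryGate (N Q w : ℕ) : Type := State N Q w ≃ₗᵢ[ℂ] State N Q w

variable {N Q w : ℕ}

/-- The index `i_j` held by the `j`-th query register. -/
def queryIndex (q : Basis N Q w) (j : Fin Q) : ℕ :=
  Nat.ofBits fun k : Fin (Nat.clog 2 N) => q (Sum.inl (j, k.castSucc))

/-- The control bit `b_j` held by the `j`-th query register. -/
def queryControl (q : Basis N Q w) (j : Fin Q) : Bool :=
  q (Sum.inl (j, Fin.last (Nat.clog 2 N)))

/-- The input bit `x(i)`; register values `i ≥ N`, which occur only if `N` is not a power of two,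
are padded by `0`. -/
def inputBit (x : Fin N → Bool) (i : ℕ) : Bool :=
  if h : i < N then x ⟨i, h⟩ else false

/-- The parallel phase query
`|i_1,b_1,…,i_Q,b_Q⟩|z⟩ ↦ (-1)^{∑_j x(i_j) b_j} |i_1,b_1,…,i_Q,b_Q⟩|z⟩`. -/
def parallelQuery (x : Fin N → Bool) (ψ : State N Q w) : State N Q w :=
  WithLp.toLp 2 fun q =>
    (-1 : ℂ) ^ (∑ j, (inputBit x (queryIndex q j) && queryControl q j).toNat) * ψ q

/-- The (unnormalized) projection of `ψ` on the outcome `m` of a computational basis measurement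
of the qubits in `S`. -/
def project (S : Finset (Qubit N Q w)) (m : S → Bool) (ψ : State N Q w) : State N Q w :=
  WithLp.toLp 2 fun q => if ∀ k : S, q k = m k then ψ q else 0

/-- The vector `ψ` rescaled to norm one. -/
def normalize (ψ : State N Q w) : State N Q w := ((‖ψ‖⁻¹ : ℝ) : ℂ) • ψ

/-- One step of the part of the circuit after the query: a unitary on all qubits, followed by a
(possibly empty) collapsing measurement of the qubits in `measured`. -/
structure Step (N Q w : ℕ) where
  gate : UnitaryGate N Q w
  measured : Finset (Qubit N Q w)

/-- `sampleProb P steps φ v` is the probability that the samples are `v 0, …, v (P - 1)` when the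
steps are run from the state `φ`. In each step the unitary is applied, the partial measurement
collapses the state (outcome `m` has probability `‖project _ m _‖ ^ 2`), and then all qubits of the
collapsed state are sampled in the computational basis without disturbing the state, which is
handed on to the next step. -/
def sampleProb : (P : ℕ) → (Fin P → Step N Q w) → State N Q w → (Fin P → Basis N Q w) → ℝ
  | 0, _, _, _ => 1
  | P + 1, steps, φ, v =>
      ∑ m : (steps 0).measured → Bool,
        let χ := project (steps 0).measured m ((steps 0).gate φ)
        ‖χ‖ ^ 2 * (‖normalize χ (v 0)‖ ^ 2 *
          sampleProb P (Fin.tail steps) (normalize χ) (Fin.tail v))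

/-- A quantum query algorithm with `Q` non-adaptive queries to an input of length `N` and `P`
non-collapsing measurements: it runs `M_P U_P ⋯ M_1 U_1 O_x^Q U_0 |0⟩`, takes a non-collapsing
sample after each `M_i`, and outputs a function of the `P` samples. -/
structure Algorithm (N Q P : ℕ) where
  /-- the number of workspace qubits -/
  w : ℕ
  /-- the unitary `U_0` -/
  prep : UnitaryGate N Q w
  /-- the pairs `U_i, M_i` -/
  steps : Fin P → Step N Q w
  /-- the classical post-processing -/
  output : (Fin P → Basis N Q w) → Bool

namespace Algorithm

variable {P : ℕ}

/-- The state `U_0 |0⟩` to which the parallel query is applied. -/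
def queryState (A : Algorithm N Q P) : State N Q A.w :=
  A.prep (EuclideanSpace.single (fun _ => false) 1)

/-- The probability that the output on input `x` differs from `b`. -/
def errorProb (A : Algorithm N Q P) (x : Fin N → Bool) (b : Bool) : ℝ :=
  ∑ v : Fin P → Basis N Q A.w,
    if A.output v = b then 0 else sampleProb P A.steps (parallelQuery x A.queryState) v

/-- `A` computes `f` with error probability at most `1/3` on every input in `S`. -/
def Computes (A : Algorithm N Q P) (f : (Fin N → Bool) → Bool) (S : Set (Fin N → Bool)) : Prop :=
  ∀ x ∈ S, A.errorProb x (f x) ≤ 1 / 3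

end Algorithm

/-- The non-adaptive complexity of `f`: the least value of `Q + P` (queries plus non-collapsing
measurements) over all algorithms that compute `f` on all inputs. -/
def complexity (f : (Fin N → Bool) → Bool) : ℕ :=
  sInf {T | ∃ Q P, Q + P = T ∧ ∃ A : Algorithm N Q P, A.Computes f Set.univ}

/-- Unstructured search: is there a marked index? -/
def search (N : ℕ) (x : Fin N → Bool) : Bool := decide (∃ i, x i = true)

/-! The quantities of the basic adversary method for sets of inputs `X`, `Y` and a relation `R`. -/

/-- The least number of partners of an element of `X`. -/
def minDegree (X : Set (Fin N → Bool)) (R : (Fin N → Bool) → (Fin N → Bool) → Prop) : ℕ :=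
  sInf {d | ∃ x ∈ X, d = Set.ncard {y | R x y}}

/-- The greatest number of partners of an element of `X` that differ from it at a given index. -/
def maxLoad (X : Set (Fin N → Bool)) (R : (Fin N → Bool) → (Fin N → Bool) → Prop) : ℕ :=
  sSup {d | ∃ x ∈ X, ∃ i, d = Set.ncard {y | R x y ∧ x i ≠ y i}}

/-- The basic adversary bound `max {m / l, m' / l'}` for non-adaptive queries. -/
def adversaryBound (X Y : Set (Fin N → Bool)) (R : (Fin N → Bool) → (Fin N → Bool) → Prop) : ℝ :=
  max ((minDegree X R : ℝ) / maxLoad X R)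
    ((minDegree Y (Function.swap R) : ℝ) / maxLoad Y (Function.swap R))

/-- The all-zero string. -/
def zeroInputs (N : ℕ) : Set (Fin N → Bool) := {fun _ => false}

/-- The strings of Hamming weight one. -/
def weightOneInputs (N : ℕ) : Set (Fin N → Bool) := {y | Set.ncard {i | y i = true} = 1}

/-- All pairs of the all-zero string and a weight-one string. -/
def searchRel (N : ℕ) (x y : Fin N → Bool) : Prop := x ∈ zeroInputs N ∧ y ∈ weightOneInputs N

/-- `f = Õ(g)`: up to a power of the logarithm. -/
def SoftO (f g : ℕ → ℝ) : Prop :=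
  ∃ k : ℕ, f =O[Filter.atTop] fun N => g N * Real.log N ^ k

/-- `f = Θ̃(g)`. -/
def SoftTheta (f g : ℕ → ℝ) : Prop := SoftO f g ∧ SoftO g f

end PDQP

end

/-! Lower bound. Low error on two inputs with different answers keeps the Bhattacharyya coefficient
(`affinity`) of their sample distributions away from `1` (`affinity_le_of_errorProb_le`). On the
other hand, if the states after the query are `φ` and `φ'`, then `P` samples lower it by at most `P
* (1 - Re ⟪φ, φ'⟫)` (`one_sub_le_affinity`), whatever gates and collapsing measurements intervene.
So this quantity is at least `1 / 20` for the zero string against each weight-one string. A basis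
state carries at most `Q` indices, so the infidelities summed over all marked positions are at most
`2 * Q`; summing over the positions gives `N / 20 ≤ 2 * Q * P`, and AM-GM gives the bound on the
sum.

Upper bound. Arrange the indices in about `√N` rows of about `√N` entries. Query a uniform
superposition of the rows, with every control in `|+⟩`: a marked entry turns its control into `|-⟩`,
and a change of basis makes this visible (`exists_algorithm`). A sample shows nothing with
probability equal to the fraction of unmarked rows, so if something is marked, `O(√N)` independent
samples find it with constant probability. The error is one-sided and no collapsing measurement is
needed. -/

noncomputable section

namespace PDQP

variable {N Q w : ℕ}

open scoped InnerProductSpace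

/-! ### Sample distributions and their affinity. -/

section Sampling

variable {S : Finset (Qubit N Q w)}

/-- Every basis label is compatible with exactly one measurement outcome. -/
theorem sum_inner_project (φ φ' : State N Q w) :
    ∑ m : S → Bool, ⟪project S m φ, project S m φ'⟫_ℂ = ⟪φ, φ'⟫_ℂ := by
  simp only [PiLp.inner_apply, project]
  rw [Finset.sum_comm]
  refine Finset.sum_congr rfl fun q _ => ?_
  rw [Finset.sum_eq_single (fun k : S => q k)]
  · simp
  · intro m _ hm
    rw [if_neg fun h => hm (funext fun k => (h k).symm)]
    simp
  · simp

theorem sum_norm_project_sq (φ : State N Q w) :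
    ∑ m : S → Bool, ‖project S m φ‖ ^ 2 = ‖φ‖ ^ 2 := by
  have h := sum_inner_project (S := S) φ φ
  simp only [inner_self_eq_norm_sq_to_K] at h
  exact_mod_cast h

theorem norm_normalize {χ : State N Q w} (h : χ ≠ 0) : ‖normalize χ‖ = 1 := by
  have : ‖χ‖ ≠ 0 := norm_ne_zero_iff.mpr h
  simp [normalize, norm_smul, this]

theorem norm_mul_inner_normalize {χ χ' : State N Q w} (h : χ ≠ 0) (h' : χ' ≠ 0) :
    ‖χ‖ * ‖χ'‖ * (⟪normalize χ, normalize χ'⟫_ℂ).re = (⟪χ, χ'⟫_ℂ).re := by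
  have h1 : ‖χ‖ ≠ 0 := norm_ne_zero_iff.mpr h
  have h2 : ‖χ'‖ ≠ 0 := norm_ne_zero_iff.mpr h'
  simp only [normalize, inner_smul_left, inner_smul_right, Complex.conj_ofReal,
    Complex.re_ofReal_mul]
  field_simp

theorem sampleProb_nonneg (P : ℕ) (steps : Fin P → Step N Q w) (φ : State N Q w)
    (v : Fin P → Basis N Q w) : 0 ≤ sampleProb P steps φ v := by
  induction P generalizing φ with
  | zero => simp [sampleProb]
  | succ P ih =>
    exact Finset.sum_nonneg fun m _ =>
      mul_nonneg (sq_nonneg _) (mul_nonneg (sq_nonneg _) (ih _ _ _))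

theorem sum_fin_succ_arrow {α M : Type*} [Fintype α] [AddCommMonoid M] {P : ℕ}
    (f : (Fin (P + 1) → α) → M) :
    ∑ v, f v = ∑ a : α, ∑ u : Fin P → α, f (Fin.cons a u) := by
  rw [← (Fin.consEquiv fun _ : Fin (P + 1) => α).sum_comp, Fintype.sum_prod_type]
  rfl

theorem sum_sampleProb (P : ℕ) (steps : Fin P → Step N Q w) {φ : State N Q w} (hφ : ‖φ‖ = 1) :
    ∑ v, sampleProb P steps φ v = 1 := by
  induction P generalizing φ with
  | zero => simp [sampleProb]
  | succ P ih =>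
    rw [sum_fin_succ_arrow]
    simp only [sampleProb, Fin.cons_zero, Fin.tail_cons]
    have key : ∀ m : (steps 0).measured → Bool,
        ∑ a, ∑ u, ‖project (steps 0).measured m ((steps 0).gate φ)‖ ^ 2 *
          (‖normalize (project (steps 0).measured m ((steps 0).gate φ)) a‖ ^ 2 *
            sampleProb P (Fin.tail steps)
              (normalize (project (steps 0).measured m ((steps 0).gate φ))) u) =
        ‖project (steps 0).measured m ((steps 0).gate φ)‖ ^ 2 := by
      intro m
      generalize project (steps 0).measured m ((steps 0).gate φ) = χ
      -- An outcome of probability zero has no unit vector to recurse on; its weight `‖χ‖ ^ 2`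
      -- removes it.
      by_cases hχ : χ = 0
      · simp [hχ]
      · simp_rw [← Finset.mul_sum, ih (Fin.tail steps) (norm_normalize hχ), mul_one,
          ← EuclideanSpace.norm_sq_eq, norm_normalize hχ]
        simp
    calc _ = ∑ m : (steps 0).measured → Bool,
          ‖project (steps 0).measured m ((steps 0).gate φ)‖ ^ 2 := by
          simp_rw [Finset.sum_comm (t := (Finset.univ : Finset ((steps 0).measured → Bool))), key]
      _ = 1 := by rw [sum_norm_project_sq, LinearIsometryEquiv.norm_map, hφ, one_pow]

/-- The Bhattacharyya coefficient of the distributions of the samples of two runs. -/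
def affinity (P : ℕ) (steps : Fin P → Step N Q w) (φ φ' : State N Q w) : ℝ :=
  ∑ v, √(sampleProb P steps φ v) * √(sampleProb P steps φ' v)

theorem affinity_le_one (P : ℕ) (steps : Fin P → Step N Q w) {φ φ' : State N Q w}
    (hφ : ‖φ‖ = 1) (hφ' : ‖φ'‖ = 1) : affinity P steps φ φ' ≤ 1 := by
  refine (Real.sum_sqrt_mul_sqrt_le _ (fun v => sampleProb_nonneg P steps φ v)
    (fun v => sampleProb_nonneg P steps φ' v)).trans ?_
  simp [sum_sampleProb P steps hφ, sum_sampleProb P steps hφ']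

theorem sum_norm_mul_norm_le_one {φ φ' : State N Q w} (hφ : ‖φ‖ = 1) (hφ' : ‖φ'‖ = 1) :
    ∑ q, ‖φ q‖ * ‖φ' q‖ ≤ 1 := by
  have h := Real.sum_mul_le_sqrt_mul_sqrt Finset.univ (fun q => ‖φ q‖) (fun q => ‖φ' q‖)
  simpa [← EuclideanSpace.norm_sq_eq, hφ, hφ'] using h

theorem re_inner_le_sum_norm_mul_norm (φ φ' : State N Q w) :
    (⟪φ, φ'⟫_ℂ).re ≤ ∑ q, ‖φ q‖ * ‖φ' q‖ := by
  rw [PiLp.inner_apply, Complex.re_sum]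
  exact Finset.sum_le_sum fun q _ => re_inner_le_norm (𝕜 := ℂ) (φ q) (φ' q)

/-- Each sample costs at most the infidelity of the two initial states. -/
theorem one_sub_le_affinity (P : ℕ) (steps : Fin P → Step N Q w) {φ φ' : State N Q w}
    (hφ : ‖φ‖ = 1) (hφ' : ‖φ'‖ = 1) :
    1 - P * (1 - (⟪φ, φ'⟫_ℂ).re) ≤ affinity P steps φ φ' := by
  induction P generalizing φ φ' with
  | zero => simp [affinity, sampleProb]
  | succ P ih =>
    set S := (steps 0).measured
    set χ : (S → Bool) → State N Q w := fun m => project S m ((steps 0).gate φ) with hχ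
    set χ' : (S → Bool) → State N Q w := fun m => project S m ((steps 0).gate φ') with hχ'
    have hinner : ∑ m, (⟪χ m, χ' m⟫_ℂ).re = (⟪φ, φ'⟫_ℂ).re := by
      rw [← Complex.re_sum, hχ, hχ', sum_inner_project, LinearIsometryEquiv.inner_map_map]
    have hnorm : ∑ m, ‖χ m‖ * ‖χ' m‖ ≤ 1 := by
      have h := Real.sum_mul_le_sqrt_mul_sqrt Finset.univ (fun m => ‖χ m‖) (fun m => ‖χ' m‖)
      simpa [hχ, hχ', sum_norm_project_sq, hφ, hφ'] using h
    have hterm : ∀ m, (P + 1) * (⟪χ m, χ' m⟫_ℂ).re - P * (‖χ m‖ * ‖χ' m‖) ≤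
        ‖χ m‖ * ‖χ' m‖ * ((∑ q, ‖normalize (χ m) q‖ * ‖normalize (χ' m) q‖) *
          affinity P (Fin.tail steps) (normalize (χ m)) (normalize (χ' m))) := by
      intro m
      by_cases h : χ m = 0
      · simp [h]
      by_cases h' : χ' m = 0
      · simp [h']
      have ha := re_inner_le_sum_norm_mul_norm (normalize (χ m)) (normalize (χ' m))
      have ha1 := sum_norm_mul_norm_le_one (norm_normalize h) (norm_normalize h')
      have hb := ih (Fin.tail steps) (norm_normalize h) (norm_normalize h')
      have hb1 := affinity_le_one P (Fin.tail steps) (norm_normalize h) (norm_normalize h')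
      rw [← norm_mul_inner_normalize h h']
      -- With `a`, `b` the affinities of the present and the later samples, `(1 - a) * (1 - b) ≥ 0`
      -- gives `a * b ≥ a + b - 1`. The resulting bound is affine in the inner product, so it can be
      -- summed over the branches `m`.
      have : (P + 1) * (⟪normalize (χ m), normalize (χ' m)⟫_ℂ).re - P ≤
          (∑ q, ‖normalize (χ m) q‖ * ‖normalize (χ' m) q‖) *
          affinity P (Fin.tail steps) (normalize (χ m)) (normalize (χ' m)) := by
        nlinarith [mul_nonneg (sub_nonneg.mpr ha1) (sub_nonneg.mpr hb1)]
      calc _ = ‖χ m‖ * ‖χ' m‖ *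
            ((P + 1) * (⟪normalize (χ m), normalize (χ' m)⟫_ℂ).re - P) := by ring
        _ ≤ _ := mul_le_mul_of_nonneg_left this (by positivity)
    calc 1 - ((P + 1 : ℕ) : ℝ) * (1 - (⟪φ, φ'⟫_ℂ).re)
        ≤ (P + 1) * ∑ m, (⟪χ m, χ' m⟫_ℂ).re - P * ∑ m, ‖χ m‖ * ‖χ' m‖ := by
          rw [hinner]; push_cast
          nlinarith [mul_le_mul_of_nonneg_left hnorm (Nat.cast_nonneg (α := ℝ) P)]
      _ = ∑ m, ((P + 1) * (⟪χ m, χ' m⟫_ℂ).re - P * (‖χ m‖ * ‖χ' m‖)) := by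
          rw [Finset.sum_sub_distrib, Finset.mul_sum, Finset.mul_sum]
      _ ≤ ∑ m, ‖χ m‖ * ‖χ' m‖ * ((∑ q, ‖normalize (χ m) q‖ * ‖normalize (χ' m) q‖) *
          affinity P (Fin.tail steps) (normalize (χ m)) (normalize (χ' m))) :=
          Finset.sum_le_sum fun m _ => hterm m
      _ = ∑ a, ∑ u, ∑ m,
            √(‖χ m‖ ^ 2 * (‖normalize (χ m) a‖ ^ 2 *
              sampleProb P (Fin.tail steps) (normalize (χ m)) u)) *
            √(‖χ' m‖ ^ 2 * (‖normalize (χ' m) a‖ ^ 2 *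
              sampleProb P (Fin.tail steps) (normalize (χ' m)) u)) := by
          simp_rw [Finset.sum_comm (t := (Finset.univ : Finset (S → Bool)))]
          refine Finset.sum_congr rfl fun m _ => ?_
          rw [affinity, Finset.sum_mul_sum, Finset.mul_sum]
          refine Finset.sum_congr rfl fun a _ => ?_
          rw [Finset.mul_sum]
          refine Finset.sum_congr rfl fun u _ => ?_
          rw [Real.sqrt_mul (sq_nonneg _), Real.sqrt_mul (sq_nonneg _),
            Real.sqrt_mul (sq_nonneg _), Real.sqrt_mul (sq_nonneg _)]
          simp only [Real.sqrt_sq (norm_nonneg _)]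
          ring
      _ ≤ affinity (P + 1) steps φ φ' := by
          rw [affinity, sum_fin_succ_arrow]
          refine Finset.sum_le_sum fun a _ => Finset.sum_le_sum fun u _ => ?_
          -- Cauchy–Schwarz over `m`: forgetting the measurement outcomes can only increase the
          -- affinity.
          refine (Real.sum_sqrt_mul_sqrt_le _
            (fun m => mul_nonneg (sq_nonneg _) (mul_nonneg (sq_nonneg _) (sampleProb_nonneg _ _ _ _)))
            (fun m => mul_nonneg (sq_nonneg _)
              (mul_nonneg (sq_nonneg _) (sampleProb_nonneg _ _ _ _)))).trans_eq ?_
          simp only [sampleProb, Fin.cons_zero, Fin.tail_cons]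
          rfl

end Sampling

/-! ### Lower bound for search. -/

theorem norm_parallelQuery (x : Fin N → Bool) (ψ : State N Q w) :
    ‖parallelQuery x ψ‖ = ‖ψ‖ := by
  simp [EuclideanSpace.norm_eq, parallelQuery]

namespace Algorithm

variable {P : ℕ}

theorem norm_queryState (A : Algorithm N Q P) : ‖A.queryState‖ = 1 := by
  simp [queryState]

/-- If two runs have nearly the same distribution of samples, they cannot be told apart. -/
theorem affinity_le_of_errorProb_le (A : Algorithm N Q P) {x y : Fin N → Bool}
    (hx : A.errorProb x false ≤ 1 / 3) (hy : A.errorProb y true ≤ 1 / 3) :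
    affinity P A.steps (parallelQuery x A.queryState) (parallelQuery y A.queryState) ≤ 19 / 20 := by
  have hp := sum_sampleProb P A.steps
    ((norm_parallelQuery x A.queryState).trans A.norm_queryState)
  have hq := sum_sampleProb P A.steps
    ((norm_parallelQuery y A.queryState).trans A.norm_queryState)
  have hp0 := sampleProb_nonneg P A.steps (parallelQuery x A.queryState)
  have hq0 := sampleProb_nonneg P A.steps (parallelQuery y A.queryState)
  unfold errorProb at hx hy
  unfold affinity
  generalize sampleProb P A.steps (parallelQuery x A.queryState) = p at *
  generalize sampleProb P A.steps (parallelQuery y A.queryState) = q at *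
  -- Weighted AM-GM with `5 / 14 * (7 / 10) = 1 / 4`, the larger weight on the run for which the
  -- output is wrong. Summing gives `5 / 7 + (12 / 35) * (2 / 3) = 33 / 35 < 19 / 20`.
  have hpoint : ∀ v, √(p v) * √(q v) ≤ 5 / 14 * p v + 5 / 14 * q v +
      (7 / 10 - 5 / 14) * (if A.output v = false then 0 else p v) +
      (7 / 10 - 5 / 14) * (if A.output v = true then 0 else q v) := by
    intro v
    have h1 := Real.sq_sqrt (hp0 v)
    have h2 := Real.sq_sqrt (hq0 v)
    rcases h : A.output v
    · simp only [if_true, Bool.false_eq_true, if_false]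
      nlinarith [sq_nonneg (5 * √(p v) - 7 * √(q v))]
    · simp only [if_true, Bool.true_eq_false, if_false]
      nlinarith [sq_nonneg (7 * √(p v) - 5 * √(q v))]
  refine (Finset.sum_le_sum fun v _ => hpoint v).trans ?_
  rw [Finset.sum_add_distrib, Finset.sum_add_distrib, Finset.sum_add_distrib,
    ← Finset.mul_sum, ← Finset.mul_sum, ← Finset.mul_sum, ← Finset.mul_sum, hp, hq]
  linarith

end Algorithm

/-- The string whose only marked index is `i`. -/
def mark (i : Fin N) : Fin N → Bool := fun k => decide (k = i)

theorem mark_mem_weightOneInputs (i : Fin N) : mark i ∈ weightOneInputs N := by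
  simp [weightOneInputs, mark]

theorem weightOneInputs_eq_range : weightOneInputs N = Set.range (mark (N := N)) := by
  ext y
  refine ⟨fun h => ?_, ?_⟩
  · obtain ⟨i, hi⟩ := Set.ncard_eq_one.mp h
    refine ⟨i, funext fun k => ?_⟩
    have : y k = true ↔ k = i := by simpa using Set.ext_iff.mp hi k
    rw [Bool.eq_iff_iff, this, mark, decide_eq_true_iff]
  · rintro ⟨i, rfl⟩
    exact mark_mem_weightOneInputs i

theorem mark_injective : Function.Injective (mark (N := N)) := by
  intro i k h
  simpa [mark] using congrFun h i

theorem search_zero : search N (fun _ => false) = false := by simp [search]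

theorem search_mark (i : Fin N) : search N (mark i) = true := by simp [search, mark]

/-- The query is diagonal, so the inner product is a signed sum of the `‖ψ q‖ ^ 2`, and a sign can
be negative only if some register of `q` holds `i`. -/
theorem one_sub_re_inner_parallelQuery_mark_le {ψ : State N Q w} (hψ : ‖ψ‖ = 1) (i : Fin N) :
    1 - (⟪parallelQuery (fun _ => false) ψ, parallelQuery (mark i) ψ⟫_ℂ).re ≤
      ∑ q, ‖ψ q‖ ^ 2 * (2 * ∑ j, if queryIndex q j = i then 1 else 0) := by
  have h1 : (1 : ℝ) = ∑ q, ‖ψ q‖ ^ 2 := by rw [← EuclideanSpace.norm_sq_eq, hψ, one_pow]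
  rw [PiLp.inner_apply, Complex.re_sum]
  nth_rewrite 1 [h1]
  rw [← Finset.sum_sub_distrib]
  refine Finset.sum_le_sum fun q _ => ?_
  set e := ∑ j, (inputBit (mark i) (queryIndex q j) && queryControl q j).toNat with he
  have hzero : ∑ j, (inputBit (fun _ : Fin N => false) (queryIndex q j) &&
      queryControl q j).toNat = 0 := by
    refine Finset.sum_eq_zero fun j _ => ?_
    simp [inputBit]
  have hval : (⟪parallelQuery (fun _ => false) ψ q, parallelQuery (mark i) ψ q⟫_ℂ).re =
      (-1) ^ e * ‖ψ q‖ ^ 2 := by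
    simp only [parallelQuery, hzero, pow_zero, one_mul, ← he]
    rw [← smul_eq_mul, inner_smul_right, inner_self_eq_norm_sq_to_K]
    have : ((-1 : ℂ) ^ e) = (((-1 : ℝ) ^ e : ℝ) : ℂ) := by push_cast; rfl
    rw [this, Complex.re_ofReal_mul]
    norm_cast
  have hle : (e : ℝ) ≤ ∑ j, if queryIndex q j = i then 1 else 0 := by
    rw [he]; push_cast
    refine Finset.sum_le_sum fun j _ => ?_
    by_cases h : queryIndex q j = i
    · simp only [h, if_true]
      exact_mod_cast Bool.toNat_le _
    · have : inputBit (mark i) (queryIndex q j) = false := by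
        simp only [inputBit, mark]
        split_ifs with hlt
        · exact decide_eq_false fun h' => h (congrArg Fin.val h')
        · rfl
      simp [h, this]
  have hsign : 1 - (-1 : ℝ) ^ e ≤ 2 * e := by
    rcases Nat.eq_zero_or_pos e with h | h
    · simp [h]
    · have : (1 : ℝ) ≤ e := by exact_mod_cast h
      rcases neg_one_pow_eq_or ℝ e with h' | h' <;> rw [h'] <;> linarith
  rw [hval]
  nlinarith [mul_le_mul_of_nonneg_left (hsign.trans (mul_le_mul_of_nonneg_left hle zero_le_two))
    (sq_nonneg ‖ψ q‖)]

theorem sum_one_sub_re_inner_parallelQuery_mark_le {ψ : State N Q w} (hψ : ‖ψ‖ = 1) :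
    ∑ i : Fin N, (1 - (⟪parallelQuery (fun _ => false) ψ, parallelQuery (mark i) ψ⟫_ℂ).re) ≤
      2 * Q := by
  refine (Finset.sum_le_sum fun i _ => one_sub_re_inner_parallelQuery_mark_le hψ i).trans ?_
  rw [Finset.sum_comm]
  have h1 : ∑ q, ‖ψ q‖ ^ 2 = 1 := by rw [← EuclideanSpace.norm_sq_eq, hψ, one_pow]
  calc _ ≤ ∑ q, ‖ψ q‖ ^ 2 * (2 * (Q : ℝ)) := ?_
    _ = 2 * (Q : ℝ) := by rw [← Finset.sum_mul, h1, one_mul]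
  refine Finset.sum_le_sum fun q _ => ?_
  rw [← Finset.mul_sum, ← Finset.mul_sum, Finset.sum_comm]
  gcongr
  calc ∑ j : Fin Q, ∑ i : Fin N, (if queryIndex q j = i then (1 : ℝ) else 0)
      ≤ ∑ _j : Fin Q, 1 := Finset.sum_le_sum fun j _ => ?_
    _ = Q := by simp
  -- A register holds at most one index, and none if its value is a padding value `≥ N`.
  rw [Finset.sum_boole]
  exact_mod_cast Finset.card_le_one.mpr fun a ha b hb => Fin.ext <| by
    simp only [Finset.mem_filter] at ha hb
    exact ha.2.symm.trans hb.2

/-- Distinguishing the all-zero string from the weight-one strings needs `QP = Ω(N)`. -/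
theorem Algorithm.Computes.le_mul {P : ℕ} {A : Algorithm N Q P}
    (hA : A.Computes (search N) (zeroInputs N ∪ weightOneInputs N)) :
    1 / 40 * (N : ℝ) ≤ Q * P := by
  have hx : A.errorProb (fun _ => false) false ≤ 1 / 3 := by
    have := hA (fun _ => false) (Or.inl rfl)
    rwa [search_zero] at this
  have hi : ∀ i : Fin N, (1 / 20 : ℝ) ≤ P * (1 - (⟪parallelQuery (fun _ => false) A.queryState,
      parallelQuery (mark i) A.queryState⟫_ℂ).re) := by
    intro i
    have hy := hA (mark i) (Or.inr (mark_mem_weightOneInputs i))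
    rw [search_mark] at hy
    have h1 := A.affinity_le_of_errorProb_le hx hy
    have h2 := one_sub_le_affinity P A.steps
      ((norm_parallelQuery (fun _ => false) A.queryState).trans A.norm_queryState)
      ((norm_parallelQuery (mark i) A.queryState).trans A.norm_queryState)
    linarith
  have hsum := Finset.sum_le_sum fun i (_ : i ∈ Finset.univ) => hi i
  rw [← Finset.mul_sum] at hsum
  have h2 := mul_le_mul_of_nonneg_left (sum_one_sub_re_inner_parallelQuery_mark_le
    A.norm_queryState) (Nat.cast_nonneg (α := ℝ) P)
  have h3 := hsum.trans h2
  simp only [Finset.sum_const, Finset.card_univ, Fintype.card_fin, nsmul_eq_mul] at h3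
  linarith

theorem Algorithm.Computes.sqrt_le_add {P : ℕ} {A : Algorithm N Q P}
    (hA : A.Computes (search N) (zeroInputs N ∪ weightOneInputs N)) :
    1 / 40 * √(N : ℝ) ≤ Q + P := by
  have h := hA.le_mul
  have hN := Real.sq_sqrt (Nat.cast_nonneg (α := ℝ) N)
  refine (sq_le_sq₀ (by positivity) (by positivity)).mp ?_
  -- `(Q + P) ^ 2 ≥ 4 * Q * P ≥ N / 10`, more than the required `N / 1600`.
  nlinarith [sq_nonneg ((Q : ℝ) - P),
    mul_nonneg (Nat.cast_nonneg (α := ℝ) Q) (Nat.cast_nonneg (α := ℝ) P)]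

/-! ### The adversary quantities of search. -/

theorem setOf_searchRel_zero : {y | searchRel N (fun _ => false) y} = weightOneInputs N := by
  simp [searchRel, zeroInputs]

theorem minDegree_zeroInputs : minDegree (zeroInputs N) (searchRel N) = N := by
  have : {d | ∃ x ∈ zeroInputs N, d = Set.ncard {y | searchRel N x y}} = {N} := by
    ext d
    simp only [zeroInputs, Set.mem_singleton_iff, exists_eq_left, Set.mem_ofPred_eq]
    rw [setOf_searchRel_zero, weightOneInputs_eq_range, Set.ncard_range_of_injective mark_injective]
    simp
  rw [minDegree, this, csInf_singleton]

/-- For `N = 0` there is no index, and the supremum of the empty set would be `0`. -/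
theorem maxLoad_zeroInputs (hN : 1 ≤ N) : maxLoad (zeroInputs N) (searchRel N) = 1 := by
  have h : ∀ i : Fin N, {y | searchRel N (fun _ => false) y ∧ false ≠ y i} = {mark i} := by
    intro i
    ext y
    have : searchRel N (fun _ => false) y ↔ y ∈ weightOneInputs N := by
      simp [searchRel, zeroInputs]
    simp only [Set.mem_ofPred_eq, this, weightOneInputs_eq_range, Set.mem_singleton_iff]
    constructor
    · rintro ⟨⟨k, rfl⟩, hk⟩
      have : i = k := by simpa [mark] using hk
      rw [this]
    · rintro rfl
      exact ⟨⟨i, rfl⟩, by simp [mark]⟩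
  have : {d | ∃ x ∈ zeroInputs N, ∃ i, d = Set.ncard {y | searchRel N x y ∧ x i ≠ y i}} = {1} := by
    ext d
    simp only [zeroInputs, Set.mem_singleton_iff, exists_eq_left, Set.mem_ofPred_eq, h,
      Set.ncard_singleton]
    exact ⟨fun ⟨_, h⟩ => h, fun h => ⟨⟨0, hN⟩, h⟩⟩
  rw [maxLoad, this, csSup_singleton]

theorem setOf_swap_searchRel_mark (i : Fin N) :
    {x | Function.swap (searchRel N) (mark i) x} = {fun _ => false} := by
  ext x
  simp [Function.swap, searchRel, zeroInputs, mark_mem_weightOneInputs]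

theorem minDegree_weightOneInputs (hN : 1 ≤ N) :
    minDegree (weightOneInputs N) (Function.swap (searchRel N)) = 1 := by
  have : {d | ∃ y ∈ weightOneInputs N,
      d = Set.ncard {x | Function.swap (searchRel N) y x}} = {1} := by
    ext d
    simp only [weightOneInputs_eq_range, Set.exists_range_iff, setOf_swap_searchRel_mark,
      Set.ncard_singleton, Set.mem_ofPred_eq, Set.mem_singleton_iff]
    exact ⟨fun ⟨_, h⟩ => h, fun h => ⟨⟨0, hN⟩, h⟩⟩
  rw [minDegree, this, csInf_singleton]

theorem maxLoad_weightOneInputs (hN : 1 ≤ N) :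
    maxLoad (weightOneInputs N) (Function.swap (searchRel N)) = 1 := by
  have hle : ∀ i k : Fin N,
      {x | Function.swap (searchRel N) (mark i) x ∧ mark i k ≠ x k} ⊆ {fun _ => false} := by
    intro i k
    rw [← setOf_swap_searchRel_mark i]
    exact fun x hx => hx.1
  -- The load is `1` at the marked index and `0` elsewhere, so the set of loads need not be a
  -- singleton.
  refine IsGreatest.csSup_eq ⟨⟨mark ⟨0, hN⟩, mark_mem_weightOneInputs _, ⟨0, hN⟩, ?_⟩, ?_⟩
  · symm
    rw [Set.ncard_eq_one]
    refine ⟨fun _ => false, (hle _ _).antisymm ?_⟩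
    rintro _ rfl
    exact ⟨⟨rfl, mark_mem_weightOneInputs _⟩, by simp [mark]⟩
  · rintro d ⟨y, hy, k, rfl⟩
    rw [weightOneInputs_eq_range] at hy
    obtain ⟨i, rfl⟩ := hy
    simpa using Set.ncard_le_ncard (hle i k)

theorem adversaryBound_search (hN : 1 ≤ N) :
    adversaryBound (zeroInputs N) (weightOneInputs N) (searchRel N) = N := by
  rw [adversaryBound, minDegree_zeroInputs, maxLoad_zeroInputs hN, minDegree_weightOneInputs hN,
    maxLoad_weightOneInputs hN]
  have : (1 : ℝ) ≤ N := by exact_mod_cast hN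
  simpa using this

/-! ### Independent samples of a single state. -/

/-- A step that applies a unitary and measures nothing. -/
def Step.unitary (U : UnitaryGate N Q w) : Step N Q w := ⟨U, ∅⟩

theorem sampleProb_succ_of_measured_eq_empty {P : ℕ} {steps : Fin (P + 1) → Step N Q w}
    (hsteps : (steps 0).measured = ∅) {φ : State N Q w} (hφ : ‖φ‖ = 1)
    (v : Fin (P + 1) → Basis N Q w) :
    sampleProb (P + 1) steps φ v =
      ‖(steps 0).gate φ (v 0)‖ ^ 2 *
        sampleProb P (Fin.tail steps) ((steps 0).gate φ) (Fin.tail v) := by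
  have : IsEmpty (steps 0).measured := by rw [hsteps]; infer_instance
  have hproj : ∀ m, project (steps 0).measured m ((steps 0).gate φ) = (steps 0).gate φ := by
    intro m
    ext q
    exact if_pos fun k => isEmptyElim k
  have hnorm : normalize ((steps 0).gate φ) = (steps 0).gate φ := by simp [normalize, hφ]
  simp only [sampleProb, hproj, hnorm]
  simp [hφ]

theorem sampleProb_const_refl (P : ℕ) {χ : State N Q w} (hχ : ‖χ‖ = 1)
    (v : Fin P → Basis N Q w) :
    sampleProb P (fun _ => Step.unitary (LinearIsometryEquiv.refl ℂ _)) χ v =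
      ∏ t, ‖χ (v t)‖ ^ 2 := by
  induction P with
  | zero => simp [sampleProb]
  | succ P ih =>
    rw [sampleProb_succ_of_measured_eq_empty rfl hχ, Fin.prod_univ_succ]
    exact congrArg _ (ih _)

/-- Applying one unitary once and then sampling repeatedly yields independent samples. -/
theorem sampleProb_cons_refl (P : ℕ) (U : UnitaryGate N Q w) {φ : State N Q w} (hφ : ‖φ‖ = 1)
    (v : Fin (P + 1) → Basis N Q w) :
    sampleProb (P + 1) (Fin.cons (Step.unitary U)
      fun _ => Step.unitary (LinearIsometryEquiv.refl ℂ _)) φ v = ∏ t, ‖U φ (v t)‖ ^ 2 := by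
  rw [sampleProb_succ_of_measured_eq_empty rfl hφ, Fin.tail_cons, Fin.cons_zero,
    sampleProb_const_refl P (by simpa using hφ), Fin.prod_univ_succ]
  rfl

/-! ### One parallel query with controls in `|+⟩`. -/

/-- The contents of the index qubits of all query registers. -/
abbrev IndexBits (N Q : ℕ) : Type := Fin Q → Fin (Nat.clog 2 N) → Bool

/-- Basis labels without workspace, split into index bits and control bits. -/
def splitBasis (N Q : ℕ) : Basis N Q 0 ≃ IndexBits N Q × (Fin Q → Bool) where
  toFun q := (fun j k => q (Sum.inl (j, k.castSucc)), queryControl q)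
  invFun p := Sum.elim
    (fun r => Fin.lastCases (motive := fun _ => Bool) (p.2 r.1) (fun k => p.1 r.1 k) r.2) Fin.elim0
  left_inv q := by
    funext r
    rcases r with ⟨j, k⟩ | k
    · refine Fin.lastCases ?_ (fun k => ?_) k <;> simp [queryControl]
    · exact k.elim0
  right_inv p := by
    ext <;> simp [queryControl]

theorem queryControl_eq (q : Basis N Q 0) : queryControl q = (splitBasis N Q q).2 := rfl

theorem sum_splitBasis {M : Type*} [AddCommMonoid M]
    (f : IndexBits N Q × (Fin Q → Bool) → M) :
    ∑ q, f (splitBasis N Q q) = ∑ d, ∑ b, f (d, b) := by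
  rw [(splitBasis N Q).sum_comp f, Fintype.sum_prod_type]

/-- The state whose index qubits hold `d` and whose control qubits are in the state `|+⟩`. -/
def plusState (d : IndexBits N Q) : State N Q 0 :=
  WithLp.toLp 2 fun q => if (splitBasis N Q q).1 = d then (((√2 ^ Q)⁻¹ : ℝ) : ℂ) else 0

theorem sqrt_two_pow_inv_mul_self : (√2 ^ Q)⁻¹ * (√2 ^ Q)⁻¹ * (2 : ℝ) ^ Q = 1 := by
  rw [← mul_inv, ← mul_pow, Real.mul_self_sqrt zero_le_two]
  exact inv_mul_cancel₀ (by positivity)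

theorem inner_plusState (d : IndexBits N Q) (g : IndexBits N Q → (Fin Q → Bool) → ℂ) :
    ⟪plusState d, WithLp.toLp 2 fun q => g (splitBasis N Q q).1 (splitBasis N Q q).2⟫_ℂ =
      (((√2 ^ Q)⁻¹ : ℝ) : ℂ) * ∑ b, g d b := by
  rw [PiLp.inner_apply]
  simp only [plusState]
  rw [sum_splitBasis fun p => ⟪if p.1 = d then (((√2 ^ Q)⁻¹ : ℝ) : ℂ) else 0, g p.1 p.2⟫_ℂ,
    Finset.sum_eq_single d, Finset.mul_sum]
  · refine Finset.sum_congr rfl fun b _ => ?_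
    simp [mul_comm]
  · intro d' _ h
    simp [h]
  · simp

theorem orthonormal_plusState : Orthonormal ℂ (plusState (N := N) (Q := Q)) := by
  rw [orthonormal_iff_ite]
  intro d d'
  have h := inner_plusState d fun e _ => if e = d' then (((√2 ^ Q)⁻¹ : ℝ) : ℂ) else 0
  refine h.trans ?_
  split_ifs
  · simp only [Finset.sum_const, Finset.card_univ, Fintype.card_fun, Fintype.card_bool,
      Fintype.card_fin, nsmul_eq_mul]
    have := sqrt_two_pow_inv_mul_self (Q := Q)
    rw [mul_left_comm, mul_comm]
    exact_mod_cast this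
  · simp

/-- The uniform superposition of the index contents in `D`, with all controls in `|+⟩`. -/
def rowState (D : Finset (IndexBits N Q)) : State N Q 0 :=
  WithLp.toLp 2 fun q =>
    if (splitBasis N Q q).1 ∈ D then (((√2 ^ Q)⁻¹ * (√D.card)⁻¹ : ℝ) : ℂ) else 0

theorem norm_rowState {D : Finset (IndexBits N Q)} (hD : D.Nonempty) : ‖rowState D‖ = 1 := by
  have hc : (0 : ℝ) < D.card := by exact_mod_cast hD.card_pos
  rw [← sq_eq_sq₀ (norm_nonneg _) zero_le_one, one_pow, EuclideanSpace.norm_sq_eq]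
  simp only [rowState]
  rw [sum_splitBasis fun p =>
    ‖if p.1 ∈ D then (((√2 ^ Q)⁻¹ * (√D.card)⁻¹ : ℝ) : ℂ) else 0‖ ^ 2]
  have : ∀ d : IndexBits N Q, ∑ _b : Fin Q → Bool,
      ‖if d ∈ D then (((√2 ^ Q)⁻¹ * (√D.card)⁻¹ : ℝ) : ℂ) else 0‖ ^ 2 =
        if d ∈ D then (D.card : ℝ)⁻¹ else 0 := by
    intro d
    split_ifs
    · rw [Complex.norm_real, Real.norm_eq_abs, sq_abs, Finset.sum_const, Finset.card_univ,
        Fintype.card_fun, Fintype.card_bool, Fintype.card_fin, nsmul_eq_mul, mul_pow, inv_pow,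
        inv_pow, Real.sq_sqrt hc.le, ← pow_mul, mul_comm Q 2, pow_mul, Real.sq_sqrt zero_le_two]
      push_cast
      rw [← mul_assoc, mul_inv_cancel₀ (by positivity), one_mul]
    · simp
  simp_rw [this]
  rw [Finset.sum_ite_mem, Finset.univ_inter, Finset.sum_const, nsmul_eq_mul,
    mul_inv_cancel₀ hc.ne']

/-- The input bits read by registers with index contents `d` are all `0`. -/
def Unmarked (x : Fin N → Bool) (d : IndexBits N Q) : Prop :=
  ∀ j, inputBit x (Nat.ofBits (d j)) = false

/-- The sum factors over the registers; a register reading `1` contributes `1 + (-1) = 0`. -/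
theorem sum_sign_eq (u : Fin Q → Bool) :
    ∑ b : Fin Q → Bool, (-1 : ℂ) ^ (∑ j, (u j && b j).toNat) =
      if ∀ j, u j = false then 2 ^ Q else 0 := by
  have h : ∑ b : Fin Q → Bool, (-1 : ℂ) ^ (∑ j, (u j && b j).toNat) =
      ∏ j, ∑ c : Bool, (-1 : ℂ) ^ (u j && c).toNat := by
    rw [Finset.prod_univ_sum, Fintype.piFinset_univ]
    exact Finset.sum_congr rfl fun b _ => (Finset.prod_pow_eq_pow_sum _ _ _).symm
  rw [h]
  split_ifs with hu
  · simp [hu, one_add_one_eq_two]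
  · push Not at hu
    obtain ⟨j, hj⟩ := hu
    refine Finset.prod_eq_zero (Finset.mem_univ j) ?_
    simp [hj]

-- A marked row is orthogonal to its unqueried `|+⟩` state, while an unmarked row keeps its full
-- amplitude `(√D.card)⁻¹`.
open Classical in
theorem norm_inner_plusState_sq (D : Finset (IndexBits N Q)) (x : Fin N → Bool)
    (d : IndexBits N Q) :
    ‖⟪plusState d, parallelQuery x (rowState D)⟫_ℂ‖ ^ 2 =
      if d ∈ D ∧ Unmarked x d then (D.card : ℝ)⁻¹ else 0 := by
  have h := inner_plusState d fun e b =>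
    (-1 : ℂ) ^ (∑ j, (inputBit x (Nat.ofBits (e j)) && b j).toNat) *
      if e ∈ D then (((√2 ^ Q)⁻¹ * (√D.card)⁻¹ : ℝ) : ℂ) else 0
  have h' : ⟪plusState d, parallelQuery x (rowState D)⟫_ℂ = _ := h
  rw [h', ← Finset.sum_mul, sum_sign_eq fun j => inputBit x (Nat.ofBits (d j))]
  by_cases hd : d ∈ D
  · by_cases hu : Unmarked x d
    · rw [if_pos hd, if_pos (show ∀ j, _ from hu), if_pos ⟨hd, hu⟩]
      have : (((√2 ^ Q)⁻¹ : ℝ) : ℂ) * (2 ^ Q * (((√2 ^ Q)⁻¹ * (√D.card)⁻¹ : ℝ) : ℂ)) =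
          (((√D.card)⁻¹ : ℝ) : ℂ) := by
        have h2 := sqrt_two_pow_inv_mul_self (Q := Q)
        have : (√2 ^ Q)⁻¹ * (2 ^ Q * ((√2 ^ Q)⁻¹ * (√D.card)⁻¹)) = (√D.card)⁻¹ := by
          linear_combination (√D.card)⁻¹ * h2
        exact_mod_cast this
      rw [this, Complex.norm_real, Real.norm_eq_abs, sq_abs, inv_pow,
        Real.sq_sqrt (Nat.cast_nonneg _)]
    · rw [if_neg (show ¬ ∀ j, _ from hu)]
      simp [hu]
  · simp [hd]

theorem exists_gate_map_single (ψ : State N Q w) (hψ : ‖ψ‖ = 1) (q : Basis N Q w) :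
    ∃ U : UnitaryGate N Q w, U (EuclideanSpace.single q 1) = ψ := by
  have ho : Orthonormal ℂ (Set.domRestrict {q} fun _ : Basis N Q w => ψ) :=
    ⟨fun _ => hψ, fun a b hab => (hab (Subsingleton.elim a b)).elim⟩
  obtain ⟨b, hb⟩ := ho.exists_orthonormalBasis_extension_of_card_eq (by simp)
  exact ⟨b.repr.symm, by rw [b.repr_symm_single, hb q rfl]⟩

/-- A unitary that turns the `|+⟩` states of the controls into `|0⟩`. -/
theorem exists_gate_apply_eq_inner_plusState (N Q : ℕ) :
    ∃ U : UnitaryGate N Q 0, ∀ (φ : State N Q 0) (d : IndexBits N Q),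
      U φ ((splitBasis N Q).symm (d, fun _ => false)) = ⟪plusState d, φ⟫_ℂ := by
  -- Only the coordinates with all controls clear are prescribed; any completion to an orthonormal
  -- basis serves, so Hadamard gates need not be written out.
  have ho : Orthonormal ℂ (Set.domRestrict {q : Basis N Q 0 | ∀ j, queryControl q j = false}
      fun q => plusState (splitBasis N Q q).1) := by
    refine orthonormal_plusState.comp
      (fun q : {q : Basis N Q 0 | ∀ j, queryControl q j = false} => (splitBasis N Q q).1) ?_
    rintro ⟨q, hq⟩ ⟨r, hr⟩ h
    refine Subtype.ext ((splitBasis N Q).injective (Prod.ext h (funext fun j => ?_)))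
    exact (hq j).trans (hr j).symm
  obtain ⟨b, hb⟩ := ho.exists_orthonormalBasis_extension_of_card_eq (by simp)
  refine ⟨b.repr, fun φ d => ?_⟩
  rw [b.repr_apply_apply, hb]
  · simp
  · intro j
    simp [queryControl_eq]

open Classical in
/-- Repeated sampling of one parallel query whose index registers run over `D`. -/
theorem exists_algorithm (P : ℕ) {D : Finset (IndexBits N Q)} (hD : D.Nonempty) :
    ∃ A : Algorithm N Q (P + 1),
      (∀ q, A.queryState q ≠ 0 → ∃ d ∈ D, ∀ j, queryIndex q j = Nat.ofBits (d j)) ∧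
      ∀ x, A.errorProb x true = ((D.filter (Unmarked x)).card / D.card : ℝ) ^ (P + 1) ∧
        A.errorProb x false = 1 - ((D.filter (Unmarked x)).card / D.card : ℝ) ^ (P + 1) := by
  obtain ⟨V, hV⟩ := exists_gate_map_single (rowState D) (norm_rowState hD) fun _ => false
  obtain ⟨U, hU⟩ := exists_gate_apply_eq_inner_plusState N Q
  let A : Algorithm N Q (P + 1) :=
    { w := 0
      prep := V
      steps := Fin.cons (Step.unitary U) fun _ => Step.unitary (LinearIsometryEquiv.refl ℂ _)
      output := fun v => decide (∃ t j, queryControl (v t) j = true) }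
  have hstate : A.queryState = rowState D := hV
  refine ⟨A, fun q hq => ?_, fun x => ?_⟩
  · rw [hstate] at hq
    refine ⟨(splitBasis N Q q).1, ?_, fun j => rfl⟩
    by_contra h
    exact hq (if_neg h)
  set φ := parallelQuery x (rowState D) with hφ
  have hnorm : ‖φ‖ = 1 := (norm_parallelQuery x _).trans (norm_rowState hD)
  have hprob : ∀ v, sampleProb (P + 1) A.steps (parallelQuery x A.queryState) v =
      ∏ t, ‖U φ (v t)‖ ^ 2 := by
    intro v
    rw [hstate]
    exact sampleProb_cons_refl P U hnorm v
  have hclear : ∑ q : Basis N Q 0, (if ∀ j, queryControl q j = false then ‖U φ q‖ ^ 2 else 0) =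
      (D.filter (Unmarked x)).card / D.card := by
    have h1 := sum_splitBasis (N := N) (Q := Q) fun p =>
      if ∀ j, p.2 j = false then ‖U φ ((splitBasis N Q).symm p)‖ ^ 2 else 0
    simp only [Equiv.symm_apply_apply] at h1
    refine h1.trans ?_
    have h2 : ∀ d : IndexBits N Q, ∑ b : Fin Q → Bool,
        (if ∀ j, b j = false then ‖U φ ((splitBasis N Q).symm (d, b))‖ ^ 2 else 0) =
        if d ∈ D ∧ Unmarked x d then (D.card : ℝ)⁻¹ else 0 := by
      intro d
      rw [Finset.sum_eq_single fun _ => false, if_pos fun _ => rfl, hU, hφ, norm_inner_plusState_sq]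
      · intro b _ hb
        rw [if_neg fun h => hb (funext h)]
      · simp
    rw [Finset.sum_congr rfl fun d _ => h2 d, ← Finset.sum_filter, Finset.sum_const, nsmul_eq_mul,
      div_eq_mul_inv]
    congr 3
    ext d
    simp
  have htrue : A.errorProb x true = ((D.filter (Unmarked x)).card / D.card : ℝ) ^ (P + 1) := by
    -- The output is `false` exactly when all samples are clear, and the power of the one-sample
    -- probability expands into a sum over sample sequences.
    rw [← hclear, Fintype.sum_pow, Algorithm.errorProb]
    refine Finset.sum_congr rfl fun v _ => ?_
    rw [hprob]
    by_cases h : ∀ t j, queryControl (v t) j = false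
    · have ho : A.output v = false := by simp [A, h]
      rw [ho, if_neg Bool.false_ne_true]
      exact Finset.prod_congr rfl fun t _ => (if_pos (h t)).symm
    · have ho : A.output v = true := by simpa [A] using h
      rw [ho, if_pos rfl]
      obtain ⟨t, ht⟩ := not_forall.mp h
      exact (Finset.prod_eq_zero (Finset.mem_univ t) (if_neg ht)).symm
  refine ⟨htrue, ?_⟩
  have hsum : A.errorProb x true + A.errorProb x false = 1 := by
    rw [Algorithm.errorProb, Algorithm.errorProb, ← Finset.sum_add_distrib,
      ← sum_sampleProb (P + 1) A.steps
        ((norm_parallelQuery x A.queryState).trans A.norm_queryState)]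
    refine Finset.sum_congr rfl fun v _ => ?_
    cases A.output v <;> simp
  linarith

/-! ### Rows that cover all indices. -/

theorem inputBit_coe (x : Fin N → Bool) (i : Fin N) : inputBit x i = x i := by
  simp [inputBit]

/-- The index bits that hold the indices `c`. -/
def indexBits (c : Fin Q → Fin N) : IndexBits N Q := fun j k => (c j : ℕ).testBit k

theorem ofBits_indexBits (c : Fin Q → Fin N) (j : Fin Q) :
    Nat.ofBits (indexBits c j) = c j := by
  unfold indexBits
  rw [Nat.ofBits_testBit]
  exact Nat.mod_eq_of_lt ((c j).2.trans_le (Nat.le_pow_clog one_lt_two N))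

/-- `2 * t` samples already suffice: `(1 - 1 / t) ^ t ≤ exp (-1) < 1 / 2`, and the square is below
`1 / 4`. -/
theorem one_sub_inv_pow_le {t s : ℕ} (ht : 0 < t) (hts : t ≤ s) :
    (1 - (t : ℝ)⁻¹) ^ (2 * s + 1) ≤ 1 / 3 := by
  have ht' : (1 : ℝ) ≤ t := by exact_mod_cast ht
  have h0 : 0 ≤ 1 - (t : ℝ)⁻¹ := sub_nonneg.mpr (inv_le_one_of_one_le₀ ht')
  have h1 : 1 - (t : ℝ)⁻¹ ≤ 1 := by simp
  calc (1 - (t : ℝ)⁻¹) ^ (2 * s + 1) ≤ (1 - (t : ℝ)⁻¹) ^ (t * 2) :=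
        pow_le_pow_of_le_one h0 h1 (by omega)
    _ = ((1 - (t : ℝ)⁻¹) ^ t) ^ 2 := pow_mul _ _ _
    _ ≤ (Real.exp (-1)) ^ 2 := by
        gcongr
        calc (1 - (t : ℝ)⁻¹) ^ t ≤ (Real.exp (-(t : ℝ)⁻¹)) ^ t := by
              gcongr
              exact Real.one_sub_le_exp_neg _
          _ = Real.exp (-1) := by
              rw [← Real.exp_nat_mul]
              congr 1
              field_simp
    _ ≤ 1 / 3 := by
        have := Real.exp_neg_one_lt_half
        nlinarith [Real.exp_pos (-1)]

/-- If `s` tuples cover all indices, `2 s + 1` samples suffice to find a marked one. -/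
theorem exists_algorithm_of_cover {s : ℕ} (hs : 0 < s) (row : Fin s → Fin Q → Fin N)
    (hrow : ∀ i, ∃ a j, row a j = i) :
    ∃ A : Algorithm N Q (2 * s + 1),
      (∀ q, A.queryState q ≠ 0 → ∃ a, ∀ j, queryIndex q j = row a j) ∧
      A.Computes (search N) Set.univ := by
  classical
  set D : Finset (IndexBits N Q) := Finset.univ.image fun a => indexBits (row a) with hDdef
  have hD : D.Nonempty := ⟨indexBits (row ⟨0, hs⟩), by simp [hDdef]⟩
  -- Rows may coincide, so only an inequality holds; fewer distinct rows only help.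
  have hcard : D.card ≤ s := Finset.card_image_le.trans (by simp)
  obtain ⟨A, hA, herr⟩ := exists_algorithm (2 * s) hD
  refine ⟨A, fun q hq => ?_, fun x _ => ?_⟩
  · obtain ⟨d, hd, hq⟩ := hA q hq
    obtain ⟨a, -, rfl⟩ := Finset.mem_image.mp hd
    exact ⟨a, fun j => (hq j).trans (ofBits_indexBits _ j)⟩
  have hpos : (0 : ℝ) < D.card := by exact_mod_cast hD.card_pos
  by_cases hx : ∃ i, x i = true
  · have hsearch : search N x = true := by simpa [search] using hx
    rw [hsearch, (herr x).1]
    obtain ⟨i, hi⟩ := hx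
    obtain ⟨a, j, rfl⟩ := hrow i
    have hmarked : ¬ Unmarked x (indexBits (row a)) := by
      intro h
      have := h j
      rw [ofBits_indexBits, inputBit_coe, hi] at this
      exact absurd this (by simp)
    have hlt : (D.filter (Unmarked x)).card < D.card :=
      Finset.card_lt_card (Finset.filter_ssubset.mpr
        ⟨_, Finset.mem_image_of_mem _ (Finset.mem_univ a), hmarked⟩)
    have hle : ((D.filter (Unmarked x)).card / D.card : ℝ) ≤ 1 - (D.card : ℝ)⁻¹ := by
      have : ((D.filter (Unmarked x)).card : ℝ) + 1 ≤ D.card := by exact_mod_cast hlt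
      rw [div_le_iff₀ hpos, sub_mul, inv_mul_cancel₀ hpos.ne']
      linarith
    exact (pow_le_pow_left₀ (by positivity) hle _).trans (one_sub_inv_pow_le hD.card_pos hcard)
  · have hsearch : search N x = false := by simpa [search] using hx
    have hfilter : D.filter (Unmarked x) = D := by
      refine Finset.filter_true_of_mem fun d _ j => ?_
      simp only [not_exists, Bool.not_eq_true] at hx
      simp [inputBit, hx]
    rw [hsearch, (herr x).2, hfilter, div_self hpos.ne']
    norm_num

theorem ncard_val_mod_eq_le {s : ℕ} (hN : N ≤ s * s) (r : ℕ) :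
    Set.ncard {i : Fin N | (i : ℕ) % s = r} ≤ s := by
  have hmaps : ∀ i ∈ {i : Fin N | (i : ℕ) % s = r}, (i : ℕ) / s ∈ (Finset.range s : Set ℕ) := by
    intro i _
    simpa using Nat.div_lt_of_lt_mul (i.2.trans_le hN)
  have hinj : Set.InjOn (fun i : Fin N => (i : ℕ) / s) {i : Fin N | (i : ℕ) % s = r} := by
    intro i hi k hk h
    have hi' : (i : ℕ) % s = r := hi
    have hk' : (k : ℕ) % s = r := hk
    have h' : (i : ℕ) / s = (k : ℕ) / s := h
    refine Fin.ext ?_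
    rw [← Nat.div_add_mod (i : ℕ) s, ← Nat.div_add_mod (k : ℕ) s, hi', hk', h']
  simpa using Set.ncard_le_ncard_of_injOn _ hmaps hinj

/-- Blocks of indices congruent modulo `s`, each queried by its own register. -/
theorem exists_block_algorithm {s : ℕ} (hs : 0 < s) (hsN : s ≤ N) (hN : N ≤ s * s) :
    ∃ (part : Fin N → Fin s) (A : Algorithm N s (2 * s + 1)),
      (∀ j, Set.ncard {i | part i = j} ≤ s) ∧
      (∀ q, A.queryState q ≠ 0 → ∀ j, ∃ i : Fin N, queryIndex q j = i ∧ part i = j) ∧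
      A.Computes (search N) Set.univ := by
  -- Entries beyond `N` are replaced by `j`, which is below `N` because `s ≤ N` and keeps the
  -- residue modulo `s`, so register `j` stays in its part.
  let row : Fin s → Fin s → Fin N := fun a j =>
    if h : s * a + j < N then ⟨s * a + j, h⟩ else ⟨j, j.2.trans_le hsN⟩
  have hmod : ∀ a j, (row a j : ℕ) % s = j := by
    intro a j
    simp only [row]
    split_ifs <;> simp [Nat.mod_eq_of_lt j.2]
  have hcover : ∀ i, ∃ a j, row a j = i := by
    intro i
    refine ⟨⟨i / s, Nat.div_lt_of_lt_mul (i.2.trans_le hN)⟩, ⟨i % s, Nat.mod_lt _ hs⟩, ?_⟩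
    simp only [row, Nat.div_add_mod, i.2, dite_true]
  obtain ⟨A, hA, hcomp⟩ := exists_algorithm_of_cover hs row hcover
  refine ⟨fun i => ⟨i % s, Nat.mod_lt _ hs⟩, A, fun j => ?_, fun q hq j => ?_, hcomp⟩
  · simpa [Fin.ext_iff] using ncard_val_mod_eq_le hN (j : ℕ)
  · obtain ⟨a, ha⟩ := hA q hq
    exact ⟨row a j, ha j, Fin.ext (hmod a j)⟩

theorem exists_sqrt_block_algorithm (hN : 1 ≤ N) :
    ∃ (part : Fin N → Fin ⌈√(N : ℝ)⌉₊)
      (A : Algorithm N ⌈√(N : ℝ)⌉₊ (2 * ⌈√(N : ℝ)⌉₊ + 1)),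
      (∀ j, Set.ncard {i | part i = j} ≤ ⌈√(N : ℝ)⌉₊) ∧
      (∀ q, A.queryState q ≠ 0 → ∀ j, ∃ i : Fin N, queryIndex q j = i ∧ part i = j) ∧
      A.Computes (search N) Set.univ := by
  have hN' : (1 : ℝ) ≤ N := by exact_mod_cast hN
  have hsqrt : 1 ≤ √(N : ℝ) := Real.one_le_sqrt.mpr hN'
  have hsq := Real.mul_self_sqrt (zero_le_one.trans hN')
  refine exists_block_algorithm (Nat.ceil_pos.mpr (by linarith)) ?_ ?_
  · exact Nat.ceil_le.mpr (by nlinarith)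
  · have h := Nat.le_ceil √(N : ℝ)
    have : (N : ℝ) ≤ (⌈√(N : ℝ)⌉₊ : ℝ) * ⌈√(N : ℝ)⌉₊ :=
      hsq.symm.le.trans (mul_self_le_mul_self (by linarith) h)
    exact_mod_cast this

/-! ### The complexity of search. -/

theorem ceil_sqrt_le (hN : 1 ≤ N) : (⌈√(N : ℝ)⌉₊ : ℝ) ≤ 2 * √(N : ℝ) := by
  have hsqrt : 1 ≤ √(N : ℝ) := Real.one_le_sqrt.mpr (by exact_mod_cast hN)
  have := Nat.ceil_lt_add_one (Real.sqrt_nonneg (N : ℝ))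
  linarith

theorem complexity_search_le (hN : 1 ≤ N) : (complexity (search N) : ℝ) ≤ 7 * √(N : ℝ) := by
  obtain ⟨-, A, -, -, hA⟩ := exists_sqrt_block_algorithm hN
  have h : complexity (search N) ≤ ⌈√(N : ℝ)⌉₊ + (2 * ⌈√(N : ℝ)⌉₊ + 1) :=
    Nat.sInf_le ⟨_, _, rfl, A, hA⟩
  have h' : (complexity (search N) : ℝ) ≤ ⌈√(N : ℝ)⌉₊ + (2 * ⌈√(N : ℝ)⌉₊ + 1) := by
    exact_mod_cast h
  have hsqrt : 1 ≤ √(N : ℝ) := Real.one_le_sqrt.mpr (by exact_mod_cast hN)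
  have := ceil_sqrt_le hN
  linarith

theorem le_complexity_search (hN : 1 ≤ N) : 1 / 40 * √(N : ℝ) ≤ complexity (search N) := by
  obtain ⟨-, A, -, -, hA⟩ := exists_sqrt_block_algorithm hN
  -- The algorithm `A` makes the set of costs nonempty; otherwise `sInf` would be the default `0`.
  obtain ⟨Q, P, h, B, hB⟩ := Nat.sInf_mem (s := {T | ∃ Q P, Q + P = T ∧
    ∃ A : Algorithm N Q P, A.Computes (search N) Set.univ}) ⟨_, _, _, rfl, A, hA⟩
  have hle := Algorithm.Computes.sqrt_le_add (A := B) fun x _ => hB x (Set.mem_univ x)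
  rw [complexity, ← h]
  exact_mod_cast hle

theorem softTheta_complexity_search :
    SoftTheta (fun N => (complexity (search N) : ℝ)) (fun N => √(N : ℝ)) := by
  refine ⟨⟨0, Asymptotics.IsBigO.of_bound 7 ?_⟩, ⟨0, Asymptotics.IsBigO.of_bound 40 ?_⟩⟩ <;>
    filter_upwards [Filter.eventually_ge_atTop 1] with N hN <;>
    simp only [pow_zero, mul_one, Real.norm_eq_abs, Nat.abs_cast, abs_of_nonneg (Real.sqrt_nonneg _)]
  · exact complexity_search_le hN
  · linarith [le_complexity_search hN]

end PDQP

end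

theorem mainTheorem10 :
    -- lower bound, by the basic adversary quantities of `{0}` and the weight-one strings
    (∃ c : ℝ, 0 < c ∧ ∀ N : ℕ, 1 ≤ N →
      (PDQP.minDegree (PDQP.zeroInputs N) (PDQP.searchRel N) = N ∧
        PDQP.minDegree (PDQP.weightOneInputs N) (Function.swap (PDQP.searchRel N)) = 1 ∧
        PDQP.maxLoad (PDQP.zeroInputs N) (PDQP.searchRel N) = 1 ∧
        PDQP.maxLoad (PDQP.weightOneInputs N) (Function.swap (PDQP.searchRel N)) = 1) ∧
      ∀ (Q P : ℕ) (A : PDQP.Algorithm N Q P),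
        A.Computes (PDQP.search N) (PDQP.zeroInputs N ∪ PDQP.weightOneInputs N) →
          c * PDQP.adversaryBound (PDQP.zeroInputs N) (PDQP.weightOneInputs N)
              (PDQP.searchRel N) ≤ (Q : ℝ) * P ∧
            c * √(N : ℝ) ≤ (Q : ℝ) + P) ∧
    -- upper bound: `⌈√N⌉` parallel queries, the `j`-th one to the `j`-th part of a partition
    (∃ (C : ℝ) (k : ℕ), ∀ N : ℕ, 2 ≤ N →
      ∃ P : ℕ, (P : ℝ) ≤ C * √(N : ℝ) * Real.log N ^ k ∧
        ∃ (part : Fin N → Fin ⌈√(N : ℝ)⌉₊) (A : PDQP.Algorithm N ⌈√(N : ℝ)⌉₊ P),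
          (∀ j, Set.ncard {i | part i = j} ≤ ⌈√(N : ℝ)⌉₊) ∧
          (∀ q, A.queryState q ≠ 0 →
            ∀ j, ∃ i : Fin N, PDQP.queryIndex q j = i ∧ part i = j) ∧
          A.Computes (PDQP.search N) Set.univ) ∧
    -- the complexity of search
    PDQP.SoftTheta (fun N => (PDQP.complexity (PDQP.search N) : ℝ)) (fun N => √(N : ℝ)) := by
  refine ⟨⟨1 / 40, by norm_num, fun N hN => ⟨⟨PDQP.minDegree_zeroInputs,
    PDQP.minDegree_weightOneInputs hN, PDQP.maxLoad_zeroInputs hN,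
    PDQP.maxLoad_weightOneInputs hN⟩, fun Q P A hA => ⟨?_, hA.sqrt_le_add⟩⟩⟩,
    -- No logarithm is needed: `2 * ⌈√N⌉₊ + 1 ≤ 4 * √N + 1 ≤ 5 * √N`.
    ⟨5, 0, fun N hN => ⟨2 * ⌈√(N : ℝ)⌉₊ + 1, ?_,
      PDQP.exists_sqrt_block_algorithm (one_le_two.trans hN)⟩⟩,
    PDQP.softTheta_complexity_search⟩
  · rw [PDQP.adversaryBound_search hN]
    exact hA.le_mul
  · have hsqrt : 1 ≤ √(N : ℝ) := Real.one_le_sqrt.mpr (by exact_mod_cast one_le_two.trans hN)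
    have := PDQP.ceil_sqrt_le (one_le_two.trans hN)
    push_cast
    linarith
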